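/- Let $d\ge 1$. A marked group on $d$ generators is a pair $(\Gamma,S)$ of a group $\Gamma$ and a family $S=(s_1,\dots,s_d)$ of generators of $\Gamma$ (repetitions allowed). Two pairs $(\Gamma,S)$ and $(\Gamma',S')$ are isomorphic if there is an isomorphism $\alpha:\Gamma\to\Gamma'$ with $\alpha(s_i)=s'_i$ for all $i$. Let $X_d$ be the set of isomorphism classes $[\Gamma,S]$, with the metric $d([\Gamma_1,S_1],[\Gamma_2,S_2])=2^{-N}$, where $N\le\infty$ is the largest radius such that the balls of radius $N$ around the origin in the Cayley graphs of $(\Gamma_1,S_1)$ and $(\Gamma_2,S_2)$ are isomorphic as pointed, oriented graphs with edges labelled by $1,\dots,d$. For a discrete group $\Gamma$ let $L^1(\Gamma)$ be the convolution algebra of formal series $f=\sum_{\gamma} f_\gamma\gamma$ with complex coefficients and $\sum_\gamma|f_\gamma|<\infty$. Let $\mathcal N\Gamma$ be the von Neumann algebra of all bounded operators on $L^2(\Gamma)$ that commute with left multiplication by the elements of $\Gamma$. View $L^1(\Gamma)$ as a subalgebra of $\mathcal N\Gamma$ via $f\mapsto\sum_\gamma f_\gamma R_{\gamma^{-1}}$,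 where $R_\gamma(x)=x\gamma$. Let $\tau_{\mathcal N\Gamma}(A)=(Ae,e)$ be the canonical trace, where $e\in\Gamma\subset L^2(\Gamma)$ is the unit element. Let $\det_{\mathcal N\Gamma}$ be the Fuglede--Kadison determinant: $\det_{\mathcal N\Gamma}A=\exp\tau_{\mathcal N\Gamma}(\log|A|)$ with $|A|=(A^*A)^{1/2}$ for invertible $A\in\mathcal N\Gamma$, and $\det_{\mathcal N\Gamma}A=\lim_{\varepsilon\to0+}\det_{\mathcal N\Gamma}(|A|+\varepsilon)$ for arbitrary $A\in\mathcal N\Gamma$. Let $F_d$ be the free group on generators $g_1,\dots,g_d$. For a marked group $(\Gamma,S)$ let $\varphi:F_d\to\Gamma$ be the epimorphism with $\varphi(g_i)=s_i$, and also write $\varphi:L^1(F_d)\to L^1(\Gamma)$ for the induced map $\sum_\gamma f_\gamma\gamma\mapsto\sum_\gamma f_\gamma\varphi(\gamma)$. Then: (a) For every $\tilde f\in L^1(F_d)$, the function $T(\tilde f):X_d\to\mathbb C$, $T(\tilde f)[\Gamma,S]=\tau_{\mathcal N\Gamma}(\varphi(\tilde f))$, is well defined and continuous. (b) For every invertible element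 $\tilde f$ of $L^1(F_d)$, the function $D(\tilde f):X_d\to\mathbb R^{>0}$, $D(\tilde f)[\Gamma,S]=\det_{\mathcal N\Gamma}(\varphi(\tilde f))$, is well defined and continuous. -/

import Mathlib

open Filter Topology
open scoped ENNReal

universe u

noncomputable section

/-! ## The space of marked groups -/

/-- A pair `(Γ, S)` of a group `Γ` and a family `S = (s₁, …, s_d)` of generators of `Γ`
(repetitions are allowed). -/
structure MarkedGroup (d : ℕ) : Type (u + 1) where
  /-- the underlying group -/
  Γ : Type u
  [group : Group Γ]
  /-- the family of generators -/
  s : Fin d → Γ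
  closure_range : Subgroup.closure (Set.range s) = ⊤

attribute [instance] MarkedGroup.group

namespace MarkedGroup

variable {d : ℕ}

/-- The epimorphism from the free group `F_d` to `Γ` which maps the `i`-th generator to `s_i`. -/
def epi (G : MarkedGroup.{u} d) : FreeGroup (Fin d) →* G.Γ :=
  FreeGroup.lift G.s

theorem epi_surjective (G : MarkedGroup.{u} d) : Function.Surjective G.epi :=
  FreeGroup.lift_surjective_iff_closure_range_eq_top.2 G.closure_range

/-- The evaluation in `Γ` of an `S`-word: the letter `(i, true)` stands for `s_i` and `(i, false)`
for its inverse. -/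
def eval (G : MarkedGroup.{u} d) (w : List (Fin d × Bool)) : G.Γ :=
  (w.map fun a => cond a.2 (G.s a.1) (G.s a.1)⁻¹).prod

theorem epi_mk (G : MarkedGroup.{u} d) (w : List (Fin d × Bool)) :
    G.epi (FreeGroup.mk w) = G.eval w := rfl

/-- The vertices of the ball of radius `n` around the origin `1` in the Cayley graph of `(Γ, S)`:
the elements of word length at most `n`. -/
def ball (G : MarkedGroup.{u} d) (n : ℕ) : Set G.Γ :=
  {x | ∃ w : List (Fin d × Bool), w.length ≤ n ∧ G.eval w = x}

/-- The edges labelled `i`, from `x` to `y`, of the ball of radius `n` around the origin in the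
Cayley graph of `(Γ, S)`. The Cayley graph has an edge `x ⟶ x * s_i` labelled `i` for every `x` and
`i`. Such an edge lies in the ball of radius `n` if it is traversed by a path of length at most `n`
which starts at the origin, that is, if one of its two endpoints has distance less than `n` from the
origin. -/
def ballEdge (G : MarkedGroup.{u} d) (n : ℕ) (i : Fin d) (x y : G.Γ) : Prop :=
  y = x * G.s i ∧ ∃ m < n, x ∈ G.ball m ∨ y ∈ G.ball m

theorem one_mem_ball (G : MarkedGroup.{u} d) (n : ℕ) : (1 : G.Γ) ∈ G.ball n :=
  ⟨[], by simp, rfl⟩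

theorem ball_mono (G : MarkedGroup.{u} d) {m n : ℕ} (h : m ≤ n) : G.ball m ⊆ G.ball n :=
  fun _ ⟨w, hw, hx⟩ => ⟨w, hw.trans h, hx⟩

/-- The balls of radius `n` around the origin in the Cayley graphs of `G` and `H` are isomorphic as
pointed, oriented, labelled graphs. -/
def BallIso (G H : MarkedGroup.{u} d) (n : ℕ) : Prop :=
  ∃ e : G.ball n ≃ H.ball n,
    e ⟨1, G.one_mem_ball n⟩ = ⟨1, H.one_mem_ball n⟩ ∧
      ∀ (i : Fin d) (x y : G.ball n), G.ballEdge n i x y ↔ H.ballEdge n i (e x) (e y)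

/-- The distance `2 ^ (-N)` where `N ≤ ∞` is the largest radius for which the balls of radius `N`
around the origin are isomorphic: it is the infimum of `2 ^ (-n)` over all radii `n` for which the
balls are isomorphic (`n = 0` is always such a radius). -/
instance : Dist (MarkedGroup.{u} d) where
  dist G H := sInf {r : ℝ | ∃ n : ℕ, G.BallIso H n ∧ r = (1 / 2) ^ n}

theorem dist_def (G H : MarkedGroup.{u} d) :
    dist G H = sInf {r : ℝ | ∃ n : ℕ, G.BallIso H n ∧ r = (1 / 2) ^ n} := rfl

/-- Two pairs `(Γ, S)` and `(Γ', S')` are isomorphic if there is an isomorphism `Γ ≃ Γ'` which maps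
`s_i` to `s'_i` for all `i`. -/
instance setoid (d : ℕ) : Setoid (MarkedGroup.{u} d) where
  r G H := ∃ α : G.Γ ≃* H.Γ, ∀ i, α (G.s i) = H.s i
  iseqv :=
    { refl := fun G => ⟨MulEquiv.refl _, fun _ => rfl⟩
      symm := fun ⟨α, h⟩ => ⟨α.symm, fun i => by rw [← h i, MulEquiv.symm_apply_apply]⟩
      trans := fun ⟨α, h⟩ ⟨β, k⟩ =>
        ⟨α.trans β, fun i => by rw [MulEquiv.trans_apply, h i, k i]⟩ }

/-! Facts used to show that the distance is well defined on isomorphism classes and a metric. -/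

theorem eval_append_singleton (G : MarkedGroup.{u} d) (w : List (Fin d × Bool))
    (a : Fin d × Bool) : G.eval (w ++ [a]) = G.eval w * cond a.2 (G.s a.1) (G.s a.1)⁻¹ := by
  simp [eval]

theorem eval_mem_ball (G : MarkedGroup.{u} d) {w : List (Fin d × Bool)} {n : ℕ}
    (hw : w.length ≤ n) : G.eval w ∈ G.ball n := ⟨w, hw, rfl⟩

theorem ballIso_apply_eval {G H : MarkedGroup.{u} d} {n : ℕ} (e : G.ball n ≃ H.ball n)
    (h1 : e ⟨1, G.one_mem_ball n⟩ = ⟨1, H.one_mem_ball n⟩)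
    (he : ∀ (i : Fin d) (x y : G.ball n), G.ballEdge n i x y ↔ H.ballEdge n i (e x) (e y))
    (w : List (Fin d × Bool)) (hw : w.length ≤ n) :
    (e ⟨G.eval w, G.eval_mem_ball hw⟩ : H.Γ) = H.eval w := by
  induction w using List.reverseRecOn with
  | nil => exact congrArg Subtype.val h1
  | append_singleton w a ih =>
    have hlt : w.length < n := by simpa using hw
    have ih := ih hlt.le
    obtain ⟨i, b⟩ := a
    have key := G.eval_append_singleton w (i, b)
    cases b
    · have := (he i ⟨_, G.eval_mem_ball hw⟩ ⟨_, G.eval_mem_ball hlt.le⟩).1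
        ⟨by simp [key], w.length, hlt, Or.inr (G.eval_mem_ball le_rfl)⟩
      have h2 := this.1
      rw [ih] at h2
      have h3 : H.eval (w ++ [(i, false)]) = H.eval w * (H.s i)⁻¹ := H.eval_append_singleton w _
      rw [h3, h2, mul_inv_cancel_right]
    · have := (he i ⟨_, G.eval_mem_ball hlt.le⟩ ⟨_, G.eval_mem_ball hw⟩).1
        ⟨by simp [key], w.length, hlt, Or.inl (G.eval_mem_ball le_rfl)⟩
      rw [this.1, ih, eval_append_singleton]
      simp

theorem BallIso.symm {G H : MarkedGroup.{u} d} {n : ℕ} (h : G.BallIso H n) : H.BallIso G n := by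
  obtain ⟨e, h1, he⟩ := h
  exact ⟨e.symm, by rw [← h1, Equiv.symm_apply_apply], fun i x y => by simp [he]⟩

theorem BallIso.trans {G H K : MarkedGroup.{u} d} {n : ℕ} (h : G.BallIso H n)
    (k : H.BallIso K n) : G.BallIso K n := by
  obtain ⟨e, h1, he⟩ := h
  obtain ⟨f, h2, hf⟩ := k
  exact ⟨e.trans f, by simp [h1, h2], fun i x y => by simp [he, hf]⟩

theorem BallIso.mem_ball_iff {G H : MarkedGroup.{u} d} {n m : ℕ} (e : G.ball n ≃ H.ball n)
    (h1 : e ⟨1, G.one_mem_ball n⟩ = ⟨1, H.one_mem_ball n⟩)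
    (he : ∀ (i : Fin d) (x y : G.ball n), G.ballEdge n i x y ↔ H.ballEdge n i (e x) (e y))
    (hm : m ≤ n) (x : G.ball n) : (x : G.Γ) ∈ G.ball m ↔ (e x : H.Γ) ∈ H.ball m := by
  constructor
  · rintro ⟨w, hw, hx⟩
    refine ⟨w, hw, ?_⟩
    rw [← ballIso_apply_eval e h1 he w (hw.trans hm)]
    congr 2
    exact Subtype.ext hx
  · rintro ⟨w, hw, hx⟩
    refine ⟨w, hw, ?_⟩
    have := ballIso_apply_eval e h1 he w (hw.trans hm)
    rw [hx] at this
    exact congrArg Subtype.val (e.injective (Subtype.ext this))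

theorem BallIso.mono {G H : MarkedGroup.{u} d} {m n : ℕ} (h : G.BallIso H n) (hm : m ≤ n) :
    G.BallIso H m := by
  obtain ⟨e, h1, he⟩ := h
  have key := fun {k : ℕ} (hk : k ≤ n) => BallIso.mem_ball_iff e h1 he hk
  refine ⟨⟨fun x => ⟨e ⟨x, G.ball_mono hm x.2⟩, (key hm _).1 x.2⟩,
    fun y => ⟨e.symm ⟨y, H.ball_mono hm y.2⟩, (key hm _).2 (by simp)⟩,
    fun x => by simp, fun y => by simp⟩, Subtype.ext (by simp [h1]), fun i x y => ?_⟩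
  have hiff := he i ⟨x, G.ball_mono hm x.2⟩ ⟨y, G.ball_mono hm y.2⟩
  constructor
  · rintro ⟨hxy, k, hk, hb⟩
    refine ⟨(hiff.1 ⟨hxy, k, hk.trans_le hm, hb⟩).1, k, hk, ?_⟩
    exact hb.imp (key (hk.le.trans hm) _).1 (key (hk.le.trans hm) _).1
  · rintro ⟨hxy, k, hk, hb⟩
    refine ⟨(hiff.2 ⟨hxy, k, hk.trans_le hm, hb⟩).1, k, hk, ?_⟩
    exact hb.imp (key (hk.le.trans hm) _).2 (key (hk.le.trans hm) _).2

theorem map_eval {G H : MarkedGroup.{u} d} (α : G.Γ ≃* H.Γ) (h : ∀ i, α (G.s i) = H.s i)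
    (w : List (Fin d × Bool)) : α (G.eval w) = H.eval w := by
  induction w using List.reverseRecOn with
  | nil => simp [eval]
  | append_singleton w a ih =>
    obtain ⟨i, b⟩ := a
    cases b <;> simp [eval_append_singleton, ih, h]

theorem ballIso_of_equiv {G H : MarkedGroup.{u} d} (h : G ≈ H) (n : ℕ) : G.BallIso H n := by
  obtain ⟨α, h⟩ := h
  have key : ∀ (m : ℕ) (x : G.Γ), x ∈ G.ball m ↔ α x ∈ H.ball m := fun m x =>
    ⟨fun ⟨w, hw, hx⟩ => ⟨w, hw, by rw [← hx, map_eval α h]⟩,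
      fun ⟨w, hw, hx⟩ => ⟨w, hw, α.injective (by rw [← hx, map_eval α h])⟩⟩
  refine ⟨α.toEquiv.subtypeEquiv (key n), Subtype.ext (by simp), fun i x y => ?_⟩
  simp only [ballEdge, Equiv.subtypeEquiv_apply, ← key, ← h,
    ← map_mul, α.injective.eq_iff, MulEquiv.toEquiv_eq_coe, EquivLike.coe_coe]

theorem equiv_of_ballIso {G H : MarkedGroup.{u} d} (h : ∀ n, G.BallIso H n) : G ≈ H := by
  have hw : ∀ w : List (Fin d × Bool), G.eval w = 1 ↔ H.eval w = 1 := by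
    intro w
    obtain ⟨e, h1, he⟩ := h w.length
    have := ballIso_apply_eval e h1 he w le_rfl
    constructor
    · intro hG
      rw [← this]
      have h2 : (⟨G.eval w, G.eval_mem_ball le_rfl⟩ : G.ball w.length)
          = ⟨1, G.one_mem_ball _⟩ := Subtype.ext hG
      rw [h2, h1]
    · intro hH
      rw [hH] at this
      have h2 : e ⟨G.eval w, G.eval_mem_ball le_rfl⟩ = e ⟨1, G.one_mem_ball _⟩ :=
        Subtype.ext (by rw [this, h1])
      exact congrArg Subtype.val (e.injective h2)
  have hker : G.epi.ker = H.epi.ker := by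
    ext x
    induction x using Quot.inductionOn with
    | h w => exact hw w
  refine ⟨(QuotientGroup.quotientKerEquivOfSurjective G.epi G.epi_surjective).symm.trans
    ((QuotientGroup.quotientMulEquivOfEq hker).trans
      (QuotientGroup.quotientKerEquivOfSurjective H.epi H.epi_surjective)), fun i => ?_⟩
  have h1 : G.s i = QuotientGroup.quotientKerEquivOfSurjective G.epi G.epi_surjective
      (QuotientGroup.mk (FreeGroup.of i)) := (FreeGroup.lift_apply_of (f := G.s) (x := i)).symm
  rw [MulEquiv.trans_apply, h1, MulEquiv.symm_apply_apply]
  exact FreeGroup.lift_apply_of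

theorem ballIso_zero (G H : MarkedGroup.{u} d) : G.BallIso H 0 := by
  have key : ∀ (K : MarkedGroup.{u} d) (x : K.ball 0), x = ⟨1, K.one_mem_ball 0⟩ := by
    rintro K ⟨x, w, hw, rfl⟩
    obtain rfl : w = [] := List.length_eq_zero_iff.1 (Nat.le_zero.1 hw)
    rfl
  exact ⟨⟨fun _ => ⟨1, H.one_mem_ball 0⟩, fun _ => ⟨1, G.one_mem_ball 0⟩,
    fun x => (key G x).symm, fun x => (key H x).symm⟩, rfl,
    fun i x y => by simp [ballEdge]⟩

theorem dist_nonneg_aux (G H : MarkedGroup.{u} d) : 0 ≤ dist G H :=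
  Real.sInf_nonneg (by rintro _ ⟨n, -, rfl⟩; positivity)

theorem dist_le_of_ballIso {G H : MarkedGroup.{u} d} {n : ℕ} (h : G.BallIso H n) :
    dist G H ≤ (1 / 2) ^ n :=
  csInf_le ⟨0, by rintro _ ⟨n, -, rfl⟩; positivity⟩ ⟨n, h, rfl⟩

theorem ballIso_of_dist_lt {G H : MarkedGroup.{u} d} {r : ℝ} (h : dist G H < r) :
    ∃ m, G.BallIso H m ∧ (1 / 2 : ℝ) ^ m < r := by
  have hne : {r : ℝ | ∃ n : ℕ, G.BallIso H n ∧ r = (1 / 2) ^ n}.Nonempty :=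
    ⟨(1 / 2) ^ 0, 0, ballIso_zero G H, rfl⟩
  obtain ⟨_, ⟨m, hm, rfl⟩, hlt⟩ := exists_lt_of_csInf_lt hne h
  exact ⟨m, hm, hlt⟩

theorem dist_eq_zero_iff_equiv {G H : MarkedGroup.{u} d} : dist G H = 0 ↔ G ≈ H := by
  constructor
  · intro h
    refine equiv_of_ballIso fun n => ?_
    obtain ⟨m, hm, hlt⟩ := ballIso_of_dist_lt (r := (1 / 2) ^ n)
      (h.trans_lt (by positivity))
    exact hm.mono ((pow_lt_pow_iff_right_of_lt_one₀ (by norm_num) (by norm_num)).1 hlt).le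
  · intro h
    refine le_antisymm (ge_of_tendsto' (tendsto_pow_atTop_nhds_zero_of_lt_one
      (r := (1 / 2 : ℝ)) (by norm_num) (by norm_num)) fun n =>
        dist_le_of_ballIso (ballIso_of_equiv h n)) (dist_nonneg_aux G H)

theorem dist_symm_aux (G H : MarkedGroup.{u} d) : dist G H = dist H G := by
  simp only [dist_def]
  congr 1
  ext r
  exact exists_congr fun n => and_congr_left fun _ => ⟨BallIso.symm, BallIso.symm⟩

theorem dist_ultra_aux (G H K : MarkedGroup.{u} d) : dist G K ≤ max (dist G H) (dist H K) := by
  refine le_of_forall_gt fun r hr => ?_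
  obtain ⟨h1, h2⟩ := max_lt_iff.1 hr
  obtain ⟨m, hm, hmr⟩ := ballIso_of_dist_lt h1
  obtain ⟨n, hn, hnr⟩ := ballIso_of_dist_lt h2
  rcases le_total m n with h | h
  · exact (dist_le_of_ballIso (hm.trans (hn.mono h))).trans_lt hmr
  · exact (dist_le_of_ballIso ((hm.mono h).trans hn)).trans_lt hnr

theorem dist_triangle_aux (G H K : MarkedGroup.{u} d) : dist G K ≤ dist G H + dist H K :=
  (dist_ultra_aux G H K).trans
    (max_le_add_of_nonneg (dist_nonneg_aux G H) (dist_nonneg_aux H K))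

theorem dist_congr {G H G' H' : MarkedGroup.{u} d} (h : G ≈ G') (k : H ≈ H') :
    dist G H = dist G' H' := by
  simp only [dist_def]
  congr 1
  ext r
  exact exists_congr fun n => and_congr_left fun _ =>
    ⟨fun e => ((ballIso_of_equiv h n).symm.trans e).trans (ballIso_of_equiv k n),
      fun e => ((ballIso_of_equiv h n).trans e).trans (ballIso_of_equiv k n).symm⟩

end MarkedGroup

/-- The space `X_d` of marked groups on `d` generators: the set of isomorphism classes `[Γ, S]`. -/
def MarkedGroupSpace (d : ℕ) : Type (u + 1) := Quotient (MarkedGroup.setoid.{u} d)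

namespace MarkedGroup

/-- The isomorphism class `[Γ, S]` in `X_d`. -/
def toClass {d : ℕ} (G : MarkedGroup.{u} d) : MarkedGroupSpace.{u} d := Quotient.mk _ G

end MarkedGroup

/-- The metric on `X_d`; the topology of `X_d` is the one of this metric. -/
instance {d : ℕ} : MetricSpace (MarkedGroupSpace.{u} d) where
  dist := Quotient.lift₂ dist fun _ _ _ _ h k => MarkedGroup.dist_congr h k
  dist_self := by
    rintro ⟨G⟩
    exact MarkedGroup.dist_eq_zero_iff_equiv.2 (Setoid.refl G)
  dist_comm := by
    rintro ⟨G⟩ ⟨H⟩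
    exact MarkedGroup.dist_symm_aux G H
  dist_triangle := by
    rintro ⟨G⟩ ⟨H⟩ ⟨K⟩
    exact MarkedGroup.dist_triangle_aux G H K
  eq_of_dist_eq_zero := by
    rintro ⟨G⟩ ⟨H⟩ h
    exact Quotient.sound (MarkedGroup.dist_eq_zero_iff_equiv.1 h)

/-! ## `L¹(Γ)`, `L²(Γ)` and the group von Neumann algebra -/

/-- `L¹(Γ)`, the formal series `∑ f_γ γ` with `∑ |f_γ| < ∞`. -/
abbrev L1 (Γ : Type*) : Type _ := lp (fun _ : Γ => ℂ) 1

/-- The Hilbert space `L²(Γ)`. -/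
def L2 (Γ : Type*) : Type _ := lp (fun _ : Γ => ℂ) 2

namespace L1

open scoped Classical in
/-- The element `γ` of `L¹(Γ)`. -/
def single {Γ : Type*} (γ : Γ) : L1 Γ := lp.single 1 γ 1

open scoped Classical DiscreteConvolution in
/-- `f` is invertible in the convolution algebra `L¹(Γ)`, i.e. there is a `g` in `L¹(Γ)` with
`f * g = g * f = 1`, where `1` is the unit element of `Γ`, viewed as an element of `L¹(Γ)`. -/
def IsInvertible {Γ : Type*} [Group Γ] (f : L1 Γ) : Prop :=
  ∃ g : L1 Γ, f ⋆[LinearMap.mul ℂ ℂ] g = (single (1 : Γ) : Γ → ℂ) ∧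
    g ⋆[LinearMap.mul ℂ ℂ] f = (single (1 : Γ) : Γ → ℂ)

/-- The map `φ_* : L¹(Γ) → L¹(Γ')`, `∑ f_γ γ ↦ ∑ f_γ φ(γ)`, for a homomorphism `φ : Γ → Γ'`.
The series is absolutely convergent in the Banach space `L¹(Γ')`. -/
def map {Γ Γ' : Type*} [Group Γ] [Group Γ'] (φ : Γ →* Γ') (f : L1 Γ) : L1 Γ' :=
  ∑' γ, f γ • single (φ γ)

theorem summable_norm {Γ : Type*} (f : L1 Γ) : Summable fun γ => ‖f γ‖ := by
  simpa using (lp.memℓp f).summable (by simp)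

theorem norm_single {Γ : Type*} (γ : Γ) : ‖single γ‖ = 1 := by
  classical
  exact (lp.norm_single (p := 1) (E := fun _ : Γ => ℂ) (by simp) γ (1 : ℂ)).trans norm_one

theorem summable_map {Γ Γ' : Type*} [Group Γ] [Group Γ'] (φ : Γ →* Γ') (f : L1 Γ) :
    Summable fun γ => f γ • single (φ γ) :=
  Summable.of_norm (by simpa [norm_smul, norm_single] using summable_norm f)

end L1

namespace L2

variable {Γ : Type*}

instance : NormedAddCommGroup (L2 Γ) := inferInstanceAs (NormedAddCommGroup (lp (fun _ : Γ => ℂ) 2))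

instance : InnerProductSpace ℂ (L2 Γ) :=
  inferInstanceAs (InnerProductSpace ℂ (lp (fun _ : Γ => ℂ) 2))

instance : CompleteSpace (L2 Γ) := inferInstanceAs (CompleteSpace (lp (fun _ : Γ => ℂ) 2))

/-- The coefficients of an element of `L²(Γ)`. -/
def coeff (x : L2 Γ) : Γ → ℂ := x.1

instance : CoeFun (L2 Γ) fun _ => Γ → ℂ := ⟨coeff⟩

@[ext] theorem ext {x y : L2 Γ} (h : ∀ γ, x γ = y γ) : x = y := Subtype.ext (funext h)

theorem memℓp_comp (σ : Equiv.Perm Γ) (x : L2 Γ) : Memℓp (fun h => x (σ h)) 2 := by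
  have := (lp.memℓp (E := fun _ : Γ => ℂ) (p := 2) x).summable (by simp)
  exact memℓp_gen ((σ.summable_iff (f := fun h => ‖x h‖ ^ (2 : ℝ≥0∞).toReal)).2 this)

/-- The isometric operator `x ↦ x ∘ σ` on `L²(Γ)` for a permutation `σ` of `Γ`. -/
def permute (σ : Equiv.Perm Γ) : L2 Γ →ₗᵢ[ℂ] L2 Γ where
  toFun x := ⟨fun h => x (σ h), memℓp_comp σ x⟩
  map_add' _ _ := rfl
  map_smul' _ _ := rfl
  norm_map' x := by
    refine (lp.norm_eq_tsum_rpow (E := fun _ : Γ => ℂ) (p := 2) (by simp) _).trans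
      (Eq.trans ?_ (lp.norm_eq_tsum_rpow (E := fun _ : Γ => ℂ) (p := 2) (by simp) _).symm)
    congr 1
    exact σ.tsum_eq fun h => ‖x h‖ ^ (2 : ℝ≥0∞).toReal

/-- The operator `L_γ` of left multiplication `x ↦ γ x` on `L²(Γ)`; the coefficient of `γ x` at `h`
is `x (γ⁻¹ * h)`. -/
def leftMul [Group Γ] (γ : Γ) : L2 Γ →L[ℂ] L2 Γ :=
  (permute (Equiv.mulLeft γ⁻¹)).toContinuousLinearMap

/-- The operator `R_γ` of right multiplication `x ↦ x γ` on `L²(Γ)`; the coefficient of `x γ` at `h`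
is `x (h * γ⁻¹)`. -/
def rightMul [Group Γ] (γ : Γ) : L2 Γ →L[ℂ] L2 Γ :=
  (permute (Equiv.mulRight γ⁻¹)).toContinuousLinearMap

open scoped Classical in
/-- The unit element `e` of `Γ` as an element of `L²(Γ)`. -/
def e (Γ : Type*) [Group Γ] : L2 Γ := lp.single 2 (1 : Γ) 1

theorem leftMul_apply [Group Γ] (γ : Γ) (x : L2 Γ) (h : Γ) : leftMul γ x h = x (γ⁻¹ * h) := rfl

theorem rightMul_apply [Group Γ] (γ : Γ) (x : L2 Γ) (h : Γ) : rightMul γ x h = x (h * γ⁻¹) := rfl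

theorem inner_eq_tsum (x y : L2 Γ) : inner ℂ x y = ∑' γ, inner ℂ (x γ) (y γ) :=
  lp.inner_eq_tsum (G := fun _ : Γ => ℂ) x y

theorem norm_rightMul_le [Group Γ] (γ : Γ) : ‖rightMul γ‖ ≤ 1 :=
  LinearIsometry.norm_toContinuousLinearMap_le _

theorem leftMul_mul_rightMul [Group Γ] (γ δ : Γ) :
    leftMul γ * rightMul δ = rightMul δ * leftMul γ := by
  ext x h
  change x (γ⁻¹ * h * δ⁻¹) = x (γ⁻¹ * (h * δ⁻¹))
  rw [mul_assoc]

theorem star_leftMul [Group Γ] (γ : Γ) : star (leftMul γ) = leftMul γ⁻¹ := by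
  rw [ContinuousLinearMap.star_eq_adjoint, eq_comm, ContinuousLinearMap.eq_adjoint_iff]
  intro x y
  rw [inner_eq_tsum, inner_eq_tsum, ← (Equiv.mulLeft γ⁻¹).tsum_eq]
  simp [leftMul_apply]

end L2

/-- The von Neumann algebra `𝒩Γ` of `Γ`: the algebra of all bounded operators on `L²(Γ)` which
commute with left multiplication by the elements of `Γ`. -/
def groupVN (Γ : Type u) [Group Γ] : VonNeumannAlgebra (L2 Γ) where
  toStarSubalgebra := StarSubalgebra.centralizer ℂ (Set.range L2.leftMul)
  centralizer_centralizer' := by simp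

namespace groupVN

variable {Γ : Type u} [Group Γ]

theorem mem_iff {A : L2 Γ →L[ℂ] L2 Γ} :
    A ∈ groupVN Γ ↔ ∀ γ : Γ, Commute A (L2.leftMul γ) := by
  change A ∈ StarSubalgebra.centralizer ℂ (Set.range L2.leftMul) ↔ _
  rw [StarSubalgebra.mem_centralizer_iff]
  constructor
  · intro h γ
    exact (h _ ⟨γ, rfl⟩).1.symm
  · rintro h _ ⟨γ, rfl⟩
    rw [L2.star_leftMul]
    exact ⟨(h γ).symm, (h γ⁻¹).symm⟩

theorem summable_r (f : L1 Γ) : Summable fun γ : Γ => f γ • L2.rightMul γ⁻¹ := by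
  refine Summable.of_norm_bounded (L1.summable_norm f) fun γ => ?_
  rw [norm_smul]
  exact mul_le_of_le_one_right (norm_nonneg _) (L2.norm_rightMul_le _)

/-- The map `r : L¹(Γ) → 𝒩Γ`, `∑ f_γ γ ↦ ∑ f_γ R_{γ⁻¹}`, through which `L¹(Γ)` is viewed as a
subalgebra of `𝒩Γ`. The series is absolutely convergent in the operator norm. -/
def r (f : L1 Γ) : groupVN Γ :=
  ⟨∑' γ : Γ, f γ • L2.rightMul γ⁻¹, mem_iff.2 fun δ =>
    (Commute.tsum_right _ fun γ =>
      (Commute.smul_right (L2.leftMul_mul_rightMul δ γ⁻¹) (f γ))).symm⟩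

/-- The canonical trace `τ(A) = (A e, e)` on `𝒩Γ`. (The inner product of Mathlib is linear in the
second argument.) -/
def trace (A : groupVN Γ) : ℂ := inner ℂ (L2.e Γ) ((A : L2 Γ →L[ℂ] L2 Γ) (L2.e Γ))

/-- `|A| = (A^* A)^{1/2}` in `𝒩Γ`. -/
def abs (A : groupVN Γ) : groupVN Γ :=
  ⟨CFC.abs (A : L2 Γ →L[ℂ] L2 Γ), mem_iff.2 fun γ =>
    Commute.cfcAbs_left (mem_iff.1 A.2 γ)
      (by rw [L2.star_leftMul]; exact mem_iff.1 A.2 γ⁻¹)⟩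

/-- `log A` in `𝒩Γ`, obtained by the functional calculus, for a positive invertible `A`. -/
def log (A : groupVN Γ) : groupVN Γ :=
  ⟨CFC.log (A : L2 Γ →L[ℂ] L2 Γ), mem_iff.2 fun γ => (mem_iff.1 A.2 γ).cfc_real Real.log⟩

/-- The scalar operator `c • 1` in `𝒩Γ`. -/
def scalar (c : ℂ) : groupVN Γ :=
  ⟨algebraMap ℂ (L2 Γ →L[ℂ] L2 Γ) c, mem_iff.2 fun _ => Algebra.commutes c _⟩

/-- `exp τ(log |A|)`, the Fuglede--Kadison determinant of an invertible `A` in `𝒩Γ`. As `log |A|` is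
self-adjoint, its trace is real. -/
def detInvertible (A : groupVN Γ) : ℝ := Real.exp (trace (log (abs A))).re

open scoped Classical in
/-- The Fuglede--Kadison determinant of `A` in `𝒩Γ`: it is `exp τ(log |A|)` if `A` is invertible, and
`lim_{ε → 0+} det (|A| + ε)` in general. -/
def det (A : groupVN Γ) : ℝ :=
  if IsUnit A then detInvertible A
  else limUnder (𝓝[>] (0 : ℝ)) fun ε => detInvertible (abs A + scalar (ε : ℂ))

end groupVN

end

/-!
All marked groups are treated at once, in the C⋆-algebra of the uniformly bounded families
`a = (a_G)` of operators `a_G` on `L²(Γ)`, indexed by the marked groups `G = (Γ, S)`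
(`MarkedGroup.OperatorFamily`). The free group acts in it by the unitaries `u γ = (R_{φ(γ)⁻¹})_G`,
and an element `f` of `L¹(F_d)` gives the norm convergent sum `∑ f γ • u γ`
(`MarkedGroup.family`), whose component at `G` is the operator `φ(f)` in `𝒩Γ`
(`MarkedGroup.proj_family`).

The trace of `u γ` at `G` is `1` or `0` according to whether `φ(γ) = 1`. This is decided in a ball of
finite radius of the Cayley graph, so it is locally constant in `G`. As the trace at `G` is a
contraction, uniformly in `G`, the trace of every `a` in the closed star algebra generated by the
`u γ` is a continuous function of `G` (`MarkedGroup.continuous_traceAt`). This is the claim about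
the trace.

If `f` is invertible in `L¹(F_d)`, then `a = ∑ f γ • u γ` is invertible among the bounded families,
so `0` is not in the spectrum of `a⋆ a`, and `log |a| = (1/2) log (a⋆ a)` is given by the continuous
functional calculus. It lies in the closed star algebra generated by the `u γ`, and its component
at `G` is `log |φ(f)|` because star homomorphisms commute with the functional calculus. So the
determinant at `G` is the exponential of the real part of the trace at `G` of one element of that
algebra (`MarkedGroup.det_eq`), hence continuous.
-/

noncomputable section

/-! ### Bounded products of C⋆-algebras -/

instance lpInftyCStarAlgebra {I : Type*} {A : I → Type*} [∀ i, Nontrivial (A i)]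
    [∀ i, CStarAlgebra (A i)] : CStarAlgebra (lp A ∞) where

/-- The product of a family of C⋆-algebras: the families `(a i)` with `‖a i‖` bounded. It is a copy
of `lp A ∞` whose whole algebraic and metric structure is derived from one `CStarAlgebra` instance,
so that the functional calculus is found by instance search. -/
def BoundedProd {I : Type*} (A : I → Type*) [∀ i, Nontrivial (A i)] [∀ i, CStarAlgebra (A i)] :
    Type _ := lp A ∞

namespace BoundedProd

variable {I : Type*} {A : I → Type*} [∀ i, Nontrivial (A i)] [∀ i, CStarAlgebra (A i)]

instance : CStarAlgebra (BoundedProd A) :=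
  inferInstanceAs (CStarAlgebra (lp A ∞))

/-- The element of the product with given uniformly bounded components. -/
def of (a : ∀ i, A i) (C : ℝ) (h : ∀ i, ‖a i‖ ≤ C) : BoundedProd A :=
  ⟨a, memℓp_infty ⟨C, by rintro _ ⟨i, rfl⟩; exact h i⟩⟩

/-- The projection to the component with index `i`. -/
def proj (i : I) : BoundedProd A →⋆ₐ[ℂ] A i where
  toFun a := a.1 i
  map_one' := rfl
  map_mul' _ _ := rfl
  map_zero' := rfl
  map_add' _ _ := rfl
  commutes' _ := rfl
  map_star' _ := rfl

@[simp]
theorem proj_of (a : ∀ i, A i) (C : ℝ) (h : ∀ i, ‖a i‖ ≤ C) (i : I) : proj i (of a C h) = a i := rfl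

@[ext]
theorem ext {a b : BoundedProd A} (h : ∀ i, proj i a = proj i b) : a = b :=
  lp.ext (funext h)

theorem norm_proj_le (i : I) (a : BoundedProd A) : ‖proj i a‖ ≤ ‖a‖ :=
  lp.norm_apply_le_norm (E := A) ENNReal.top_ne_zero a i

theorem norm_le {a : BoundedProd A} {C : ℝ} (hC : 0 ≤ C) (h : ∀ i, ‖proj i a‖ ≤ C) : ‖a‖ ≤ C :=
  lp.norm_le_of_forall_le (E := A) hC h

theorem continuous_proj (i : I) : Continuous (proj (A := A) i) :=
  AddMonoidHomClass.continuous_of_bound (proj (A := A) i) 1 fun a => by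
    simpa using norm_proj_le i a

end BoundedProd

/-! ### The logarithm of the absolute value -/

section CFC

variable {A : Type*} [CStarAlgebra A]

/-- `Real.log x` is `log |x|`, which is continuous on all of `ℝ` but `0`, so positivity of the
spectrum is not needed. -/
theorem continuousOn_log_spectrum {b : A} (hb : IsUnit b) :
    ContinuousOn (fun x => 1 / 2 * Real.log x) (spectrum ℝ b) :=
  continuousOn_const.mul <| Real.continuousOn_log.mono fun x hx h0 => by
    rw [Set.mem_singleton_iff] at h0
    subst h0
    exact spectrum.zero_notMem ℝ hb hx

/-- `log |a| = (1/2) log (a⋆ a)`. The right-hand side makes sense without an order on the algebra, so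
it can be formed in a bounded product of C⋆-algebras and then projected to the components. -/
theorem log_abs_eq_cfc [PartialOrder A] [StarOrderedRing A] {a : A} (ha : IsUnit a) :
    CFC.log (CFC.abs a) = cfc (fun x => 1 / 2 * Real.log x) (star a * a) := by
  have h0 : 0 ≤ star a * a := star_mul_self_nonneg a
  have hspec : ∀ x ∈ spectrum ℝ (star a * a), 0 < x := fun x hx =>
    (spectrum_nonneg_of_nonneg h0 hx).lt_of_ne fun h =>
      spectrum.zero_notMem ℝ (ha.star.mul ha) (h ▸ hx)
  have habs : CFC.abs a = cfc Real.sqrt (star a * a) := by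
    rw [CFC.abs, CFC.sqrt_eq_real_sqrt _ h0, cfcₙ_eq_cfc]
  have hlog : ContinuousOn Real.log (Real.sqrt '' spectrum ℝ (star a * a)) :=
    Real.continuousOn_log.mono <| by
      rintro _ ⟨x, hx, rfl⟩
      exact (Real.sqrt_pos.2 (hspec x hx)).ne'
  rw [CFC.log, habs, ← cfc_comp Real.log Real.sqrt (star a * a) (hg := hlog)]
  refine cfc_congr fun x hx => ?_
  rw [Function.comp_apply, Real.log_sqrt (hspec x hx).le]
  ring

end CFC

/-! ### Right multiplication and the trace vector -/

open scoped Classical in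
theorem L1.single_apply {Γ : Type*} (γ δ : Γ) :
    (L1.single γ : Γ → ℂ) δ = if δ = γ then 1 else 0 :=
  (lp.single_apply (E := fun _ : Γ => ℂ) 1 γ (1 : ℂ) δ).trans (Pi.single_apply _ _ _)

namespace L2

variable {Γ : Type*} [Group Γ]

open scoped Classical in
theorem e_apply (γ : Γ) : e Γ γ = if γ = 1 then 1 else 0 := by
  refine (congrFun (lp.coeFn_single (E := fun _ : Γ => ℂ) (p := 2) (1 : Γ) (1 : ℂ)) γ).trans ?_
  exact Pi.single_apply _ _ _

theorem norm_e : ‖e Γ‖ = 1 := by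
  classical
  exact (lp.norm_single (p := 2) (E := fun _ : Γ => ℂ) (by simp) (1 : Γ) (1 : ℂ)).trans norm_one

instance : Nontrivial (L2 Γ) :=
  ⟨⟨e Γ, 0, fun h => by simpa [norm_e] using congrArg norm h⟩⟩

theorem inner_e (x : L2 Γ) : inner ℂ (e Γ) x = x 1 := by
  rw [inner_eq_tsum, tsum_eq_single 1]
  · simp [e_apply]
  · intro γ hγ
    simp [e_apply, hγ]

theorem rightMul_one : rightMul (1 : Γ) = 1 := by
  ext x h
  simp [rightMul_apply]

theorem rightMul_mul_rightMul (γ δ : Γ) : rightMul γ * rightMul δ = rightMul (δ * γ) := by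
  ext x h
  change x (h * γ⁻¹ * δ⁻¹) = x (h * (δ * γ)⁻¹)
  group

theorem star_rightMul (γ : Γ) : star (rightMul γ) = rightMul γ⁻¹ := by
  rw [ContinuousLinearMap.star_eq_adjoint, eq_comm, ContinuousLinearMap.eq_adjoint_iff]
  intro x y
  rw [inner_eq_tsum, inner_eq_tsum, ← (Equiv.mulRight γ⁻¹).tsum_eq]
  simp [rightMul_apply]

open scoped Classical in
theorem inner_e_rightMul_e (γ : Γ) :
    inner ℂ (e Γ) (rightMul γ⁻¹ (e Γ)) = if γ = 1 then (1 : ℂ) else 0 := by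
  rw [inner_e, rightMul_apply, e_apply]
  simp

end L2

/-! ### The operator of a push-forward -/

namespace groupVN

variable {Γ : Type u} [Group Γ]

/-- The map `r : L¹(Γ) → 𝒩Γ` as a continuous linear map into the bounded operators. -/
def rCLM (Γ : Type u) [Group Γ] : L1 Γ →L[ℂ] (L2 Γ →L[ℂ] L2 Γ) :=
  LinearMap.mkContinuous
    { toFun := fun f => (r f : L2 Γ →L[ℂ] L2 Γ)
      map_add' := fun f g => by
        change ∑' γ, (f γ + g γ) • L2.rightMul γ⁻¹ = _
        simp only [add_smul]
        exact (summable_r f).tsum_add (summable_r g)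
      map_smul' := fun c f => by
        change ∑' γ, (c * f γ) • L2.rightMul γ⁻¹ = _
        simp only [mul_smul]
        exact (summable_r f).tsum_const_smul c } 1 fun f => by
    have hf : ‖f‖ = ∑' γ, ‖f γ‖ := by simpa using lp.norm_eq_tsum_rpow (p := 1) (by simp) f
    rw [one_mul, hf]
    exact tsum_of_norm_bounded (L1.summable_norm f).hasSum fun γ => by
      rw [norm_smul]
      exact mul_le_of_le_one_right (norm_nonneg _) (L2.norm_rightMul_le _)

theorem rCLM_apply (f : L1 Γ) : rCLM Γ f = (r f : L2 Γ →L[ℂ] L2 Γ) := rfl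

theorem rCLM_single (γ : Γ) : rCLM Γ (L1.single γ) = L2.rightMul γ⁻¹ := by
  classical
  change ∑' δ, (L1.single γ : Γ → ℂ) δ • L2.rightMul δ⁻¹ = _
  rw [tsum_eq_single γ fun δ hδ => by simp [L1.single_apply, hδ]]
  simp [L1.single_apply]

theorem r_map {Γ' : Type*} [Group Γ'] (φ : Γ' →* Γ) (f : L1 Γ') :
    (r (L1.map φ f) : L2 Γ →L[ℂ] L2 Γ) = ∑' γ, f γ • L2.rightMul (φ γ)⁻¹ := by
  rw [← rCLM_apply, L1.map, (rCLM Γ).map_tsum (L1.summable_map φ f)]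
  simp [rCLM_single]

end groupVN

/-! ### Representations of the convolution algebra -/

section Convolution

variable {M A : Type*} [NormedRing A] [NormedAlgebra ℂ A]

theorem summable_norm_smul_of_norm_le_one {u : M → A} (hu : ∀ γ, ‖u γ‖ ≤ 1) {f : M → ℂ}
    (hf : Summable fun γ => ‖f γ‖) : Summable fun γ => ‖f γ • u γ‖ :=
  Summable.of_nonneg_of_le (fun _ => norm_nonneg _) (fun γ => by
    rw [norm_smul]
    exact mul_le_of_le_one_right (norm_nonneg _) (hu γ)) hf

open scoped DiscreteConvolution in
/-- A bounded representation `u` of `M` extends multiplicatively to the convolution algebra: both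
sides are the absolutely convergent sum of `f γ * g δ • u (γ * δ)` over all pairs `(γ, δ)`, on the
right-hand side grouped by the product `γ * δ`. -/
theorem tsum_smul_mul_tsum_smul [Monoid M] [CompleteSpace A] (u : M →* A) (hu : ∀ γ, ‖u γ‖ ≤ 1)
    {f g : M → ℂ} (hf : Summable fun γ => ‖f γ‖) (hg : Summable fun γ => ‖g γ‖) :
    (∑' γ, f γ • u γ) * (∑' γ, g γ • u γ) = ∑' γ, (f ⋆[LinearMap.mul ℂ ℂ] g) γ • u γ := by
  have hfu := summable_norm_smul_of_norm_le_one hu hf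
  have hgu := summable_norm_smul_of_norm_le_one hu hg
  let σ : (Σ γ : M, DiscreteConvolution.mulFiber γ) ≃ M × M :=
    { toFun := fun p => p.2.1
      invFun := fun p => ⟨p.1 * p.2, p, DiscreteConvolution.mem_mulFiber.2 rfl⟩
      left_inv := by
        rintro ⟨γ, p, hp⟩
        obtain rfl := DiscreteConvolution.mem_mulFiber.1 hp
        rfl
      right_inv := fun _ => rfl }
  rw [tsum_mul_tsum_of_summable_norm hfu hgu, ← σ.tsum_eq]
  refine (σ.summable_iff.2 (summable_mul_of_summable_norm hfu hgu)).tsum_sigma.trans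
    (tsum_congr fun γ => ?_)
  have hs : Summable fun p : DiscreteConvolution.mulFiber γ => f p.1.1 * g p.1.2 :=
    (summable_mul_of_summable_norm hf hg).comp_injective Subtype.val_injective
  rw [DiscreteConvolution.convolution]
  simp only [LinearMap.mul_apply']
  rw [← hs.tsum_smul_const]
  refine tsum_congr fun p => ?_
  change f p.1.1 • u p.1.1 * g p.1.2 • u p.1.2 = _
  rw [smul_mul_smul_comm, ← map_mul, DiscreteConvolution.mem_mulFiber.1 p.2]

end Convolution

/-! ### The topology of the space of marked groups -/

namespace MarkedGroup

variable {d : ℕ}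

/-- The topology of `X_d`, pulled back to marked groups. -/
instance : TopologicalSpace (MarkedGroup.{u} d) :=
  TopologicalSpace.induced toClass inferInstance

theorem isInducing_toClass : IsInducing (toClass : MarkedGroup.{u} d → MarkedGroupSpace.{u} d) :=
  ⟨rfl⟩

theorem isQuotientMap_toClass :
    IsQuotientMap (toClass : MarkedGroup.{u} d → MarkedGroupSpace.{u} d) :=
  isInducing_toClass.isQuotientMap_of_surjective Quotient.mk_surjective

/-- A continuous function on marked groups descends to isomorphism classes: isomorphic marked groups
are topologically inseparable. -/
theorem exists_continuous_lift {Y : Type*} [TopologicalSpace Y] [T0Space Y]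
    {t : MarkedGroup.{u} d → Y} (ht : Continuous t) :
    ∃ T : MarkedGroupSpace.{u} d → Y,
      Continuous T ∧ ∀ G : MarkedGroup.{u} d, T G.toClass = t G := by
  refine ⟨Quotient.lift t fun G H h => ?_, ?_, fun _ => rfl⟩
  · have hGH : G.toClass = H.toClass := Quotient.sound h
    exact ((isInducing_toClass.inseparable_iff.1 (hGH ▸ Inseparable.refl _)).map ht).eq
  · exact isQuotientMap_toClass.continuous_iff.2 ht

theorem BallIso.eval_eq_one_iff {G H : MarkedGroup.{u} d} {n : ℕ} (h : G.BallIso H n)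
    {w : List (Fin d × Bool)} (hw : w.length ≤ n) : G.eval w = 1 ↔ H.eval w = 1 := by
  obtain ⟨e, h1, he⟩ := h
  have key := ballIso_apply_eval e h1 he w hw
  have h1' : (e ⟨1, G.one_mem_ball n⟩ : H.Γ) = 1 := congrArg Subtype.val h1
  rw [← key, ← h1', Subtype.val_inj, e.injective.eq_iff, Subtype.mk.injEq]

/-- Whether a given word is a relation depends only on a ball of finite radius. -/
theorem eventually_epi_eq_one_iff (γ : FreeGroup (Fin d)) (G : MarkedGroup.{u} d) :
    ∀ᶠ H in 𝓝 G, (H.epi γ = 1 ↔ G.epi γ = 1) := by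
  obtain ⟨w, rfl⟩ := Quot.exists_rep γ
  rw [isInducing_toClass.nhds_eq_comap]
  filter_upwards [preimage_mem_comap (Metric.ball_mem_nhds G.toClass
    (ε := (1 / 2 : ℝ) ^ w.length) (by positivity))] with H hH
  obtain ⟨m, hm, hlt⟩ := ballIso_of_dist_lt (G := H) (H := G) hH
  exact hm.eval_eq_one_iff
    ((pow_lt_pow_iff_right_of_lt_one₀ (by norm_num) (by norm_num)).1 hlt).le

/-! ### Bounded families of operators over all marked groups -/

/-- The uniformly bounded families of operators, one on `L²(Γ)` for each marked group `(Γ, S)`. -/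
abbrev OperatorFamily (d : ℕ) : Type (u + 1) :=
  BoundedProd fun G : MarkedGroup.{u} d => L2 G.Γ →L[ℂ] L2 G.Γ

/-- The representation of the free group which takes `γ` to the family of the operators
`R_{φ(γ)⁻¹}`. -/
def rightRegular (d : ℕ) : FreeGroup (Fin d) →* OperatorFamily.{u} d where
  toFun γ := .of (fun G => L2.rightMul (G.epi γ)⁻¹) 1 fun _ => L2.norm_rightMul_le _
  map_one' := by
    ext1 G
    simp [L2.rightMul_one]
  map_mul' γ δ := by
    ext1 G
    simp [L2.rightMul_mul_rightMul]

theorem proj_rightRegular (γ : FreeGroup (Fin d)) (G : MarkedGroup.{u} d) :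
    BoundedProd.proj G (rightRegular d γ) = L2.rightMul (G.epi γ)⁻¹ := rfl

theorem norm_rightRegular_le (γ : FreeGroup (Fin d)) : ‖rightRegular.{u} d γ‖ ≤ 1 :=
  BoundedProd.norm_le zero_le_one fun _ => L2.norm_rightMul_le _

theorem star_rightRegular (γ : FreeGroup (Fin d)) :
    star (rightRegular.{u} d γ) = rightRegular d γ⁻¹ := by
  ext1 G
  rw [map_star, proj_rightRegular, L2.star_rightMul, proj_rightRegular, map_inv]

/-- The closed star subalgebra generated by the image of the free group in the bounded families. -/
def regularAlgebra (d : ℕ) : StarSubalgebra ℂ (OperatorFamily.{u} d) :=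
  (StarAlgebra.adjoin ℂ (Set.range (rightRegular.{u} d))).topologicalClosure

theorem isClosed_regularAlgebra : IsClosed (regularAlgebra.{u} d : Set (OperatorFamily.{u} d)) :=
  StarSubalgebra.isClosed_topologicalClosure _

theorem rightRegular_mem (γ : FreeGroup (Fin d)) : rightRegular.{u} d γ ∈ regularAlgebra d :=
  StarSubalgebra.le_topologicalClosure _ (StarAlgebra.subset_adjoin _ _ ⟨γ, rfl⟩)

theorem adjoin_rightRegular_eq_span :
    Subalgebra.toSubmodule (StarAlgebra.adjoin ℂ (Set.range (rightRegular.{u} d))).toSubalgebra =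
      Submodule.span ℂ (Set.range (rightRegular.{u} d)) := by
  have hstar : star (Set.range (rightRegular.{u} d)) ⊆ Set.range (rightRegular.{u} d) := by
    rintro a ⟨γ, hγ⟩
    exact ⟨γ⁻¹, by rw [← star_rightRegular, hγ, star_star]⟩
  rw [StarAlgebra.adjoin_eq_span, Set.union_eq_left.2 hstar, ← MonoidHom.coe_mrange,
    Submonoid.closure_eq]

/-- The trace `(a_G e, e)` of the component at `G` of a bounded family `a`. -/
def traceAt (a : OperatorFamily.{u} d) (G : MarkedGroup.{u} d) : ℂ :=
  inner ℂ (L2.e G.Γ) (BoundedProd.proj G a (L2.e G.Γ))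

theorem norm_traceAt_sub_le (a b : OperatorFamily.{u} d) (G : MarkedGroup.{u} d) :
    ‖traceAt a G - traceAt b G‖ ≤ ‖a - b‖ := by
  have h : traceAt a G - traceAt b G = inner ℂ (L2.e G.Γ)
      (BoundedProd.proj G (a - b) (L2.e G.Γ)) := by
    simp [traceAt]
  rw [h]
  calc _ ≤ ‖L2.e G.Γ‖ * ‖BoundedProd.proj G (a - b) (L2.e G.Γ)‖ := norm_inner_le_norm _ _
    _ ≤ ‖BoundedProd.proj G (a - b)‖ := by
      have := (BoundedProd.proj G (a - b)).le_opNorm (L2.e G.Γ)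
      simpa [L2.norm_e] using this
    _ ≤ ‖a - b‖ := BoundedProd.norm_proj_le _ _

theorem continuous_traceAt_rightRegular (γ : FreeGroup (Fin d)) :
    Continuous (traceAt (rightRegular.{u} d γ)) := by
  classical
  refine continuous_iff_continuousAt.2 fun G => ?_
  refine continuousAt_const.congr (f := fun _ => traceAt (rightRegular.{u} d γ) G) ?_
  filter_upwards [eventually_epi_eq_one_iff γ G] with H hH
  simp only [traceAt, proj_rightRegular, L2.inner_e_rightMul_e, hH]

/-- On the algebra generated by the free group the trace is a uniform limit of linear combinations
of the functions which indicate whether `γ` is a relation, and these are locally constant. -/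
theorem continuous_traceAt {a : OperatorFamily.{u} d} (ha : a ∈ regularAlgebra d) :
    Continuous (traceAt a) := by
  refine continuous_of_uniform_approx_of_continuous fun V hV => ?_
  obtain ⟨ε, hε, hV⟩ := Metric.mem_uniformity_dist.1 hV
  obtain ⟨b, hb, hab⟩ := Metric.mem_closure_iff.1 ha ε hε
  refine ⟨traceAt b, ?_, fun G => hV ?_⟩
  · clear hab
    have hb' : b ∈ Submodule.span ℂ (Set.range (rightRegular.{u} d)) :=
      adjoin_rightRegular_eq_span.le hb
    clear hb
    induction hb' using Submodule.span_induction with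
    | mem x hx =>
      obtain ⟨γ, rfl⟩ := hx
      exact continuous_traceAt_rightRegular γ
    | zero =>
      have h : traceAt (0 : OperatorFamily.{u} d) = fun _ => 0 := by
        funext G
        simp [traceAt]
      exact h ▸ continuous_const
    | add x y hx' hy' hx hy =>
      have h : traceAt (x + y) = fun G => traceAt x G + traceAt y G := by
        funext G
        simp [traceAt]
      exact h ▸ hx.add hy
    | smul c x hx' hx =>
      have h : traceAt (c • x) = fun G => c * traceAt x G := by
        funext G
        simp [traceAt]
      exact h ▸ continuous_const.mul hx
  · rw [dist_eq_norm] at hab ⊢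
    exact (norm_traceAt_sub_le a b G).trans_lt hab

/-! ### Elements of the convolution algebra of the free group -/

/-- The family of the operators `φ(f)` on `L²(Γ)`, for `f` in `L¹(F_d)`. -/
def family (f : L1 (FreeGroup (Fin d))) : OperatorFamily.{u} d :=
  ∑' γ, f γ • rightRegular d γ

theorem summable_family (f : L1 (FreeGroup (Fin d))) :
    Summable fun γ => f γ • rightRegular.{u} d γ :=
  (summable_norm_smul_of_norm_le_one norm_rightRegular_le (L1.summable_norm f)).of_norm

theorem family_mem (f : L1 (FreeGroup (Fin d))) : family.{u} f ∈ regularAlgebra d :=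
  tsum_mem isClosed_regularAlgebra fun γ => SMulMemClass.smul_mem _ (rightRegular_mem γ)

theorem proj_family (f : L1 (FreeGroup (Fin d))) (G : MarkedGroup.{u} d) :
    BoundedProd.proj G (family f) = (groupVN.r (L1.map G.epi f) : L2 G.Γ →L[ℂ] L2 G.Γ) := by
  rw [groupVN.r_map, family, (summable_family f).map_tsum (BoundedProd.proj G)
      (BoundedProd.continuous_proj G)]
  simp [proj_rightRegular]

theorem tsum_single_one_smul :
    ∑' γ, (L1.single (1 : FreeGroup (Fin d)) : FreeGroup (Fin d) → ℂ) γ • rightRegular.{u} d γ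
      = 1 := by
  classical
  rw [tsum_eq_single 1 fun δ hδ => by simp [L1.single_apply, hδ]]
  simp [L1.single_apply]

theorem exists_family_mul_eq_one {f : L1 (FreeGroup (Fin d))} (hf : L1.IsInvertible f) :
    ∃ g : L1 (FreeGroup (Fin d)), family.{u} f * family g = 1 ∧ family.{u} g * family f = 1 := by
  obtain ⟨g, hfg, hgf⟩ := hf
  refine ⟨g, ?_, ?_⟩
  · rw [family, family, tsum_smul_mul_tsum_smul _ norm_rightRegular_le (L1.summable_norm f)
      (L1.summable_norm g), hfg, tsum_single_one_smul]
  · rw [family, family, tsum_smul_mul_tsum_smul _ norm_rightRegular_le (L1.summable_norm g)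
      (L1.summable_norm f), hgf, tsum_single_one_smul]

/-- Over all marked groups at once, `log |φ(f)|` comes from a single functional calculus in the
algebra of bounded families. -/
theorem det_eq {f : L1 (FreeGroup (Fin d))} (hf : L1.IsInvertible f) (G : MarkedGroup.{u} d) :
    groupVN.det (groupVN.r (L1.map G.epi f)) =
      Real.exp (traceAt (cfc (fun x : ℝ => 1 / 2 * Real.log x)
        (star (family f) * family f)) G).re := by
  obtain ⟨g, hfg, hgf⟩ := exists_family_mul_eq_one.{u} hf
  have hu : IsUnit (family.{u} f) := ⟨⟨_, _, hfg, hgf⟩, rfl⟩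
  -- The inverse lies in `𝒩Γ` itself, so the determinant is the one of an invertible element.
  have hunit : IsUnit (groupVN.r (L1.map G.epi f)) := by
    refine ⟨⟨groupVN.r (L1.map G.epi f), groupVN.r (L1.map G.epi g), ?_, ?_⟩, rfl⟩
    · refine Subtype.ext ?_
      change (groupVN.r (L1.map G.epi f) : L2 G.Γ →L[ℂ] L2 G.Γ) * groupVN.r (L1.map G.epi g) = 1
      rw [← proj_family, ← proj_family, ← map_mul, hfg, map_one]
    · refine Subtype.ext ?_
      change (groupVN.r (L1.map G.epi g) : L2 G.Γ →L[ℂ] L2 G.Γ) * groupVN.r (L1.map G.epi f) = 1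
      rw [← proj_family, ← proj_family, ← map_mul, hgf, map_one]
  have hlog : CFC.log (CFC.abs (BoundedProd.proj G (family f))) =
      BoundedProd.proj G (cfc (fun x : ℝ => 1 / 2 * Real.log x) (star (family f) * family f)) := by
    rw [log_abs_eq_cfc (hu.map (BoundedProd.proj G))]
    rw [(BoundedProd.proj G).map_cfc _ _ (continuousOn_log_spectrum (hu.star.mul hu))
      (BoundedProd.continuous_proj G) (.star_mul_self _)
        (by rw [map_mul, map_star]; exact .star_mul_self _), map_mul, map_star]
  rw [groupVN.det, if_pos hunit, groupVN.detInvertible, traceAt, ← hlog, proj_family]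
  rfl

end MarkedGroup

/-! ### Continuity of the trace and of the determinant -/

theorem corollary24 (d : ℕ) :
    (∀ f : L1 (FreeGroup (Fin d)),
      ∃ T : MarkedGroupSpace.{u} d → ℂ, Continuous T ∧
        ∀ G : MarkedGroup.{u} d, T G.toClass = groupVN.trace (groupVN.r (L1.map G.epi f))) ∧
    (∀ f : L1 (FreeGroup (Fin d)), L1.IsInvertible f →
      ∃ D : MarkedGroupSpace.{u} d → {x : ℝ // 0 < x}, Continuous D ∧
        ∀ G : MarkedGroup.{u} d,
          (D G.toClass : ℝ) = groupVN.det (groupVN.r (L1.map G.epi f))) := by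
  refine ⟨fun f => ?_, fun f hf => ?_⟩
  · obtain ⟨T, hT, h⟩ := MarkedGroup.exists_continuous_lift
      (MarkedGroup.continuous_traceAt (MarkedGroup.family_mem.{u} f))
    refine ⟨T, hT, fun G => ?_⟩
    rw [h, MarkedGroup.traceAt, MarkedGroup.proj_family, groupVN.trace]
  · have hmem : cfc (fun x : ℝ => 1 / 2 * Real.log x)
        (star (MarkedGroup.family.{u} f) * MarkedGroup.family f) ∈ MarkedGroup.regularAlgebra d :=
      haveI := MarkedGroup.isClosed_regularAlgebra.{u} (d := d)
      cfc_mem (𝕜' := ℂ) _ (mul_mem (star_mem (MarkedGroup.family_mem f)) (MarkedGroup.family_mem f))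
    have hcont := Real.continuous_exp.comp
      (Complex.continuous_re.comp (MarkedGroup.continuous_traceAt hmem))
    obtain ⟨D, hD, h⟩ := MarkedGroup.exists_continuous_lift
      (hcont.subtype_mk fun G => Real.exp_pos _)
    refine ⟨D, hD, fun G => ?_⟩
    rw [h, MarkedGroup.det_eq hf]
    rfl

end
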